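/- \textbf{Setting.} Let $d\ge 3$, $\nu>1$, $\eta_0>0$. Let $(\Omega,\mathcal F,\mathbb P)$ be a probability space with an ergodic group $\{\tau_x\}_{x\in\mathbb R^d}$ of measure-preserving transformations, and let $A:\mathbb R^d\times\Omega\to\mathcal S(d)$ (symmetric $d\times d$ matrices) and $b:\mathbb R^d\times\Omega\to\mathbb R^d$ be jointly measurable and such that: (i) $A(x+y,\omega)=A(x,\tau_y\omega)$ and $b(x+y,\omega)=b(x,\tau_y\omega)$; (ii) $A(\cdot,\omega)$ and $b(\cdot,\omega)$ are bounded and Lipschitz, uniformly in $\omega$, with respect to $|M|=\mathrm{tr}(MM^t)^{1/2}$ for matrices; (iii) $\nu^{-1}I\le A\le\nu I$; (iv) there is $R>0$ such that $\sigma(A(x,\cdot),b(x,\cdot):x\in S)$ and $\sigma(A(x,\cdot),b(x,\cdot):x\in T)$ are independent whenever $S,T\subset\mathbb R^d$ satisfy $|x-y|\ge R$ for all $x\in S$, $y\in T$; (v) for every $x$ and every orthogonal $r$ preserving the coordinate axes, $(A(rx,\omega),b(rx,\omega))$ and $(rA(x,\omega)r^t,rb(x,\omega))$ have the same law; (vi)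 $|b|\le\eta_0$ and $|A-I|\le\eta_0$. Let $P_{x,\omega}$ be the law on $C([0,\infty);\mathbb R^d)$ of the diffusion started from $x$ with generator $\frac12\sum_{i,j} a_{ij}(\cdot,\omega)\partial_i\partial_j+\sum_i b_i(\cdot,\omega)\partial_i$ (the solution of the martingale problem). Let $U\subset\mathbb R^d$ be open and bounded, and satisfy an exterior ball condition: there is $r_0>0$ such that each $x\in\partial U$ admits $x^*$ with $\overline B_{r_0}(x^*)\cap\overline U=\{x\}$. \textbf{Scales.} Fix $\beta\in(0,\frac12]$, $a\in(0,\frac{\beta}{1000d}]$, $c_0>0$, and an integer $L_0$ that is a multiple of five with $L_0^a\ge 5$. For $n\ge 0$ put $L_{n+1}=\ell_nL_n$ with $\ell_n=5\lfloor L_n^a/5\rfloor$, $\tilde\kappa_n=\exp(2c_0(\log\log L_n)^2)$ and $\tilde D_n=L_n\tilde\kappa_n$. Let $\overline m$ be the smallest positive integer with $\overline m>1-\frac{\log(1-12a-a^2)}{\log(1+a)}$. Let $T_n=\inf\{s\ge0: \sup_{0\le r\le s}|X_r-X_0|\ge\tilde D_n\}$ and $$\alpha_n=\frac{1}{2dL_n^2}\,\mathbb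 E\Big[E_{0,\omega}\big|X_{L_n^2\wedge T_n}\big|^2\Big].$$ The constants $L_0,c_0,\eta_0$ are assumed to be such that $\frac1{2\nu}\le\alpha_n\le2\nu$ for all $n\ge0$. Let $W^n_x$ be the law on $C([0,\infty);\mathbb R^d)$ of Brownian motion with variance $\alpha_n$ started from $x$, i.e. of $x+\sqrt{\alpha_n}B$ for a standard Brownian motion $B$. For $\epsilon>0$ and $n\ge\overline m$ let $U/\epsilon=\{x:\epsilon x\in U\}$ and $$\tau_2^{\epsilon,n}=\inf\{kL_{n-\overline m}^2 : k\in\{0,1,2,\dots\},\ d(X_{kL_{n-\overline m}^2},U/\epsilon)\ge\tilde D_{n-\overline m}\},$$ with $\inf\emptyset=\infty$ (here and in distances). \textbf{Proposition.} There are $C>0$ and $N$ such that for all $n\ge N$ and all $\epsilon>0$ with $L_n\le\frac1\epsilon<L_{n+1}$, $$\sup_{d(x,(U/\epsilon)^c)\le 2\tilde D_{n-\overline m}}W^{n-\overline m}_x\big(\tau_2^{\epsilon,n}\ge L_{n-1}^2\big)\le C\,L_{n-1}^{-10a}.$$ -/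

import Mathlib

open MeasureTheory ProbabilityTheory Set
open scoped NNReal ENNReal

noncomputable section

/-! ### Path space -/

/-- The Euclidean space `ℝ^d`. -/
abbrev Space (d : ℕ) : Type := EuclideanSpace ℝ (Fin d)

/-- The space `C([0,∞); ℝ^d)` of continuous paths. As a subtype of the product
`ℝ≥0 → ℝ^d` it carries the sigma algebra generated by the coordinate maps. -/
abbrev CPath (d : ℕ) : Type := {X : ℝ≥0 → Space d // Continuous X}

/-- The coordinate process `X_t` on path space. -/
def coord {d : ℕ} (t : ℝ≥0) (X : CPath d) : Space d := X.1 t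

theorem measurable_coord {d : ℕ} (t : ℝ≥0) : Measurable (coord t : CPath d → Space d) :=
  (measurable_pi_apply t).comp measurable_subtype_coe

/-- The canonical filtration `σ(X_s : s ≤ t)` on path space. -/
def canonicalFiltration (d : ℕ) : Filtration ℝ≥0 (inferInstance : MeasurableSpace (CPath d)) :=
  Filtration.natural (fun t => (coord t : CPath d → Space d))
    (fun t => (measurable_coord t).stronglyMeasurable)

/-- `W` is the law on path space of a Brownian motion with variance `α` started from `x`, that is
of `x + √α B` for a standard `d`-dimensional Brownian motion `B`: the process starts from `x`, has
independent increments, and `X_t - X_s` is centered Gaussian with covariance `α (t - s) I`. -/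
structure IsBrownianLaw {d : ℕ} (α : ℝ) (x : Space d) (W : Measure (CPath d)) : Prop where
  prob : IsProbabilityMeasure W
  start : ∀ᵐ X ∂W, coord 0 X = x
  indep : HasIndepIncrements (fun t => (coord t : CPath d → Space d)) W
  law : ∀ s t : ℝ≥0, s ≤ t →
    HasLaw (fun X : CPath d => coord t X - coord s X)
      (multivariateGaussian 0 ((α * ((t : ℝ) - s)) • (1 : Matrix (Fin d) (Fin d) ℝ))) W

/-! ### Diffusions -/

/-- The partial derivative `∂_i f`. -/
def partialDeriv {d : ℕ} (i : Fin d) (f : Space d → ℝ) (y : Space d) : ℝ :=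
  fderiv ℝ f y (EuclideanSpace.single i 1)

/-- The generator `½ ∑ a_ij ∂_i ∂_j f + ∑ b_i ∂_i f`. -/
def generator {d : ℕ} (A : Space d → Matrix (Fin d) (Fin d) ℝ) (b : Space d → Space d)
    (f : Space d → ℝ) (y : Space d) : ℝ :=
  (1 / 2) * ∑ i, ∑ j, A y i j * partialDeriv i (partialDeriv j f) y
    + ∑ i, b y i * partialDeriv i f y

/-- `P` is the law of the diffusion with diffusion matrix `A` and drift `b` started from `x`:
it solves the associated martingale problem. -/
structure IsDiffusionLaw {d : ℕ} (A : Space d → Matrix (Fin d) (Fin d) ℝ)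
    (b : Space d → Space d) (x : Space d) (P : Measure (CPath d)) : Prop where
  prob : IsProbabilityMeasure P
  start : ∀ᵐ X ∂P, coord 0 X = x
  mart : ∀ f : Space d → ℝ, ContDiff ℝ ((⊤ : ℕ∞) : WithTop ℕ∞) f → HasCompactSupport f →
    Martingale (fun (t : ℝ≥0) (X : CPath d) => f (coord t X) - f (coord 0 X)
      - ∫ s in (0 : ℝ)..(t : ℝ), generator A b f (coord s.toNNReal X))
      (canonicalFiltration d) P

/-! ### The random environment and the domain -/

/-- The norm `|M| = tr(M Mᵗ)^{1/2}`. -/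
def matNorm {d : ℕ} (M : Matrix (Fin d) (Fin d) ℝ) : ℝ :=
  √ (M * M.transpose).trace

/-- The sigma algebra `σ(A(x,·), b(x,·) | x ∈ S)` on `Ω`. -/
@[reducible] def coeffSigma {d : ℕ} {Ω : Type*} (A : Space d → Ω → Matrix (Fin d) (Fin d) ℝ)
    (b : Space d → Ω → Space d) (S : Set (Space d)) : MeasurableSpace Ω :=
  ⨆ x ∈ S, (⨆ i, ⨆ j, MeasurableSpace.comap (fun ω => A x ω i j) inferInstance) ⊔
    MeasurableSpace.comap (b x) inferInstance

/-- The orthogonal transformation `r` permutes the coordinate axes. -/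
def PreservesAxes {d : ℕ} (r : Matrix (Fin d) (Fin d) ℝ) : Prop :=
  r ∈ Matrix.orthogonalGroup (Fin d) ℝ ∧
    ∀ i, ∃ j, ∀ k, k ≠ j → (r.mulVec (Pi.single i 1)) k = 0

/-- The standing assumptions on the environment `(Ω, Pr)`, the transformations `τ` and the
coefficients `A`, `b`, with ellipticity constant `ν` and perturbation parameter `η₀`. -/
structure IsSteadyEnvironment {d : ℕ} {Ω : Type*} [MeasurableSpace Ω] (Pr : Measure Ω)
    (τ : Space d → Ω → Ω) (A : Space d → Ω → Matrix (Fin d) (Fin d) ℝ)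
    (b : Space d → Ω → Space d) (ν η₀ : ℝ) : Prop where
  prob : IsProbabilityMeasure Pr
  group_zero : τ 0 = id
  group_add : ∀ x y, τ (x + y) = τ x ∘ τ y
  measurePreserving : ∀ x, MeasurePreserving (τ x) Pr Pr
  ergodic : ∀ s, MeasurableSet s → (∀ x, τ x ⁻¹' s = s) → Pr s = 0 ∨ Pr s = 1
  measurable_A : ∀ i j, Measurable (fun p : Space d × Ω => A p.1 p.2 i j)
  measurable_b : Measurable (fun p : Space d × Ω => b p.1 p.2)
  symm : ∀ x ω, (A x ω).IsSymm
  stationary : ∀ x y ω, A (x + y) ω = A x (τ y ω) ∧ b (x + y) ω = b x (τ y ω)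
  bounded_lipschitz : ∃ C : ℝ, 0 < C ∧
    (∀ x ω, ‖b x ω‖ ≤ C ∧ matNorm (A x ω) ≤ C) ∧
    (∀ x y ω, ‖b x ω - b y ω‖ ≤ C * ‖x - y‖ ∧ matNorm (A x ω - A y ω) ≤ C * ‖x - y‖)
  elliptic : ∀ x ω, (A x ω - (1 / ν) • (1 : Matrix (Fin d) (Fin d) ℝ)).PosSemidef ∧
    (ν • (1 : Matrix (Fin d) (Fin d) ℝ) - A x ω).PosSemidef
  finite_range : ∃ R : ℝ, 0 < R ∧ ∀ S T : Set (Space d), (∀ x ∈ S, ∀ y ∈ T, R ≤ dist x y) →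
    Indep (coeffSigma A b S) (coeffSigma A b T) Pr
  isotropic : ∀ r : Matrix (Fin d) (Fin d) ℝ, PreservesAxes r → ∀ x : Space d,
    IdentDistrib
      (fun ω => ((fun i j => A (Matrix.toEuclideanLin r x) ω i j : Fin d → Fin d → ℝ),
        b (Matrix.toEuclideanLin r x) ω))
      (fun ω => ((fun i j => (r * A x ω * r.transpose) i j : Fin d → Fin d → ℝ),
        (Matrix.toEuclideanLin r (b x ω) : Space d))) Pr Pr
  perturbation : ∀ x ω, ‖b x ω‖ ≤ η₀ ∧ matNorm (A x ω - 1) ≤ η₀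

/-- `U` is open, bounded and satisfies an exterior ball condition. -/
structure IsExteriorBallDomain {d : ℕ} (U : Set (Space d)) : Prop where
  isOpen : IsOpen U
  bounded : Bornology.IsBounded U
  exterior_ball : ∃ r₀ : ℝ, 0 < r₀ ∧ ∀ x ∈ frontier U, ∃ z : Space d,
    Metric.closedBall z r₀ ∩ closure U = {x}

/-- The dilated domain `U/ε`. -/
def dilate {d : ℕ} (ε : ℝ) (U : Set (Space d)) : Set (Space d) := {x | ε • x ∈ U}

/-! ### Scales -/

/-- The length scales `L_{n+1} = ℓ_n L_n`, `ℓ_n = 5 [L_n^a / 5]`. -/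
def scaleL (a : ℝ) (L₀ : ℕ) : ℕ → ℕ
  | 0 => L₀
  | n + 1 => 5 * ⌊(scaleL a L₀ n : ℝ) ^ a / 5⌋₊ * scaleL a L₀ n

/-- `κ̃_n = exp(2 c₀ (log log L_n)²)`. -/
def kappaTilde (a c₀ : ℝ) (L₀ n : ℕ) : ℝ :=
  Real.exp (2 * c₀ * (Real.log (Real.log (scaleL a L₀ n))) ^ 2)

/-- `D̃_n = L_n κ̃_n`. -/
def scaleDTilde (a c₀ : ℝ) (L₀ n : ℕ) : ℝ := scaleL a L₀ n * kappaTilde a c₀ L₀ n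

/-- The smallest positive integer `m̄` with `m̄ > 1 - log(1 - 12a - a²) / log(1 + a)`. -/
def mBar (a : ℝ) : ℕ :=
  sInf {m : ℕ | 0 < m ∧ 1 - Real.log (1 - 12 * a - a ^ 2) / Real.log (1 + a) < (m : ℝ)}

/-! ### Effective diffusivity and the discrete exit time -/

/-- The maximal excursion `X*_t = sup_{0 ≤ s ≤ t} |X_s - X_0|`. -/
def excursion {d : ℕ} (t : ℝ≥0) (X : CPath d) : ℝ :=
  sSup ((fun s => ‖coord s X - coord 0 X‖) '' Set.Iic t)

/-- The time `t ∧ T` for `T = inf {s ≥ 0 | X*_s ≥ ρ}`. -/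
def truncatedHittingTime {d : ℕ} (ρ : ℝ) (t : ℝ≥0) (X : CPath d) : ℝ≥0 :=
  sInf (insert t {s : ℝ≥0 | ρ ≤ excursion s X})

/-- The effective diffusivity `α_n = (2 d L_n²)⁻¹ 𝔼_0 |X_{L_n² ∧ T_n}|²`, the expectation being
annealed, for the quenched laws `P x ω`. -/
def effectiveDiffusivity {d : ℕ} {Ω : Type*} [MeasurableSpace Ω] (Pr : Measure Ω)
    (P : Space d → Ω → Measure (CPath d)) (a c₀ : ℝ) (L₀ n : ℕ) : ℝ :=
  1 / (2 * d * (scaleL a L₀ n : ℝ) ^ 2) *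
    ∫ ω, ∫ X, ‖coord (truncatedHittingTime (scaleDTilde a c₀ L₀ n)
      ((scaleL a L₀ n : ℝ≥0) ^ 2) X) X‖ ^ 2 ∂(P 0 ω) ∂Pr

/-- The first time `k h`, `k = 0, 1, 2, …`, at which `d(X_{kh}, V) ≥ ρ`
(infinite if there is none). -/
def discreteExitTime {d : ℕ} (h : ℝ≥0) (ρ : ℝ) (V : Set (Space d)) (X : CPath d) : ℝ≥0∞ :=
  sInf {s : ℝ≥0∞ | ∃ k : ℕ, s = ((k * h : ℝ≥0) : ℝ≥0∞) ∧
    ENNReal.ofReal ρ ≤ Metric.infEDist (coord (k * h) X) V}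

/-- The stopping time `τ_2^{ε,n}`: the first time `k L_{n-m̄}²` at which the distance from
`X_{k L_{n-m̄}²}` to `U/ε` is at least `D̃_{n-m̄}`. -/
def tauTwo {d : ℕ} (a c₀ : ℝ) (L₀ : ℕ) (U : Set (Space d)) (ε : ℝ) (n : ℕ) (X : CPath d) : ℝ≥0∞ :=
  discreteExitTime ((scaleL a L₀ (n - mBar a) : ℝ≥0) ^ 2) (scaleDTilde a c₀ L₀ (n - mBar a))
    (dilate ε U) X

end

/-! Sampled at multiples of `l² = L_{n-m̄}²`, Brownian motion is a Gaussian walk. If the start is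
within `ρ = D̃_{n-m̄}` of `U/ε`, the exterior ball condition gives a ball of radius `r = r₀/ε` near
it, and hitting the concentric ball of radius `r - ρ` forces the discrete exit. At scales below `r`
that ball looks like a half-space, so avoiding it up to time `Λ² = L_{n-1}²` should cost about
`ρ/Λ`. The proof obtains `(ρ/Λ)^(9/10)` up to a constant, with room to spare for errors.

The Lyapunov function is `S₊^(9/10)`, where `S` is the squared distance to the centre, shifted.
Strict concavity gives a negative second-order term of size `σ²r²S^(9/10-2)`, which beats the
outward drift of the squared distance while `S` is small against `r²`
(`integral_concavePower_sub_le`). A decrease by `c` per step makes `min 1 (f / (c k))` a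
supersolution for avoiding the target during `k` steps (`measure_forall_notMem_le_of_drift`), which
yields `gaussianWalk_avoid_closedBall_le`.

The choice of `m̄` gives `ρ ≤ C Λ^(1 - 100a/9)` (`exists_scaleDTilde_le`), and `9/10 · 100/9 = 10`
is the claimed exponent. -/

/-! ### Avoidance probabilities and supersolutions -/

/-- A supersolution bound for the probability that a random walk avoids a set. -/
theorem measure_forall_notMem_le {Ω E : Type*} [MeasurableSpace Ω] [AddCommGroup E]
    [MeasurableSpace E] [MeasurableAdd₂ E] {P : Measure Ω} [IsProbabilityMeasure P]
    {ξ : ℕ → Ω → E} (hξ : ∀ i, Measurable (ξ i)) (hind : iIndepFun ξ P) {μ : Measure E}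
    (hlaw : ∀ i, P.map (ξ i) = μ) {A : Set E} (hA : MeasurableSet A) {F : ℕ → E → ℝ≥0∞}
    (hF : ∀ k, Measurable (F k)) (h0 : ∀ y, F 0 y = 1) {N : ℕ}
    (hstep : ∀ k < N, ∀ y ∉ A, ∫⁻ z, F k (y + z) ∂μ ≤ F (k + 1) y) (x : E) :
    P {ω | ∀ j < N, x + ∑ i ∈ Finset.range j, ξ i ω ∉ A} ≤ F N x := by
  have hμ : IsProbabilityMeasure μ := hlaw 0 ▸ Measure.isProbabilityMeasure_map (hξ 0).aemeasurable
  set S : ℕ → Ω → E := fun j ω => x + ∑ i ∈ Finset.range j, ξ i ω with hS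
  set e : ℕ → Ω → ℝ≥0∞ := fun j => {ω | ∀ i < j, S i ω ∉ A}.indicator 1 with he
  let m : ℕ → MeasurableSpace Ω := fun j => ⨆ i ∈ Finset.range j, MeasurableSpace.comap (ξ i) ‹_›
  have hSm : ∀ i j, i ≤ j → Measurable[m j] (S i) := by
    intro i j hij
    refine Measurable.const_add (Finset.measurable_sum _ fun l hl => ?_) x
    refine Measurable.mono (comap_measurable (ξ l)) ?_ le_rfl
    exact le_iSup₂_of_le l (Finset.mem_range.2 ((Finset.mem_range.1 hl).trans_le hij)) le_rfl
  -- Avoidance at times `0, …, j` involves only the increments `ξ 0, …, ξ (j-1)`, so `e (j + 1)` is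
  -- still independent of `ξ j`.
  have hem : ∀ j, Measurable[m j] (e (j + 1)) := by
    intro j
    have hset : {ω | ∀ i < j + 1, S i ω ∉ A} = ⋂ i ∈ Finset.range (j + 1), (S i ⁻¹' A)ᶜ := by
      ext ω; simp
    have : MeasurableSet[m j] {ω | ∀ i < j + 1, S i ω ∉ A} := by
      rw [hset]
      refine Finset.measurableSet_biInter _ fun i hi => ?_
      exact (hSm i j (by simpa [Nat.lt_succ_iff] using hi) hA).compl
    exact (@measurable_one _ _ _ (m j) _).indicator this
  have hind' : ∀ j, IndepFun (fun ω => (S j ω, e (j + 1) ω)) (ξ j) P := by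
    intro j
    have h := indep_iSup_of_disjoint (fun i => (hξ i).comap_le) hind
      (S := (Finset.range j : Set ℕ)) (T := {j}) (by simp)
    rw [IndepFun_iff_Indep]
    refine indep_of_indep_of_le_left (indep_of_indep_of_le_right h ?_) ?_
    · simp
    · exact ((hSm j j le_rfl).prodMk (hem j)).comap_le
  have hm : ∀ j, m j ≤ ‹MeasurableSpace Ω› := fun j => iSup₂_le fun i _ => (hξ i).comap_le
  have hSm' : ∀ j, Measurable (S j) := fun j => (hSm j j le_rfl).mono (hm j) le_rfl
  have hem' : ∀ j, Measurable (e (j + 1)) := fun j => (hem j).mono (hm j) le_rfl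
  -- The expectation is nonincreasing in `j`: it starts at `F N x` and ends at the avoidance
  -- probability. `hstep` is needed only where `e (j + 1) = 1`, that is, off `A`.
  have key : ∀ j ≤ N, ∫⁻ ω, e j ω * F (N - j) (S j ω) ∂P ≤ F N x := by
    intro j
    induction j with
    | zero => intro _; simp [he, hS]
    | succ j ih =>
      intro hj
      refine le_trans ?_ (ih (by omega))
      have hG : Measurable fun p : (E × ℝ≥0∞) × E => p.1.2 * F (N - (j + 1)) (p.1.1 + p.2) :=
        (measurable_snd.comp measurable_fst).mul
          ((hF _).comp ((measurable_fst.comp measurable_fst).add measurable_snd))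
      have hpair : Measurable fun ω => (S j ω, e (j + 1) ω) := (hSm' j).prodMk (hem' j)
      have h1 : ∫⁻ ω, e (j + 1) ω * F (N - (j + 1)) (S (j + 1) ω) ∂P
          = ∫⁻ ω, e (j + 1) ω * ∫⁻ z, F (N - (j + 1)) (S j ω + z) ∂μ ∂P := by
        have h2 : ∫⁻ ω, e (j + 1) ω * F (N - (j + 1)) (S (j + 1) ω) ∂P
            = ∫⁻ p, p.1.2 * F (N - (j + 1)) (p.1.1 + p.2)
              ∂(P.map fun ω => ((S j ω, e (j + 1) ω), ξ j ω)) := by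
          rw [lintegral_map hG (hpair.prodMk (hξ j))]
          simp [hS, Finset.sum_range_succ, add_assoc]
        rw [h2, (indepFun_iff_map_prod_eq_prod_map_map hpair.aemeasurable
          (hξ j).aemeasurable).1 (hind' j), hlaw, lintegral_prod _ hG.aemeasurable,
          lintegral_map hG.lintegral_prod_right' hpair]
        refine lintegral_congr fun ω => ?_
        rw [lintegral_const_mul]
        exact (hF _).comp (measurable_const_add _)
      rw [h1]
      refine lintegral_mono fun ω => ?_
      by_cases hω : ∀ i < j + 1, S i ω ∉ A
      · have e1 : e (j + 1) ω = 1 := indicator_of_mem (s := {ω | ∀ i < j + 1, S i ω ∉ A}) hω 1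
        have e2 : e j ω = 1 := indicator_of_mem (s := {ω | ∀ i < j, S i ω ∉ A})
          (fun i hi => hω i (by omega)) 1
        have := hstep (N - (j + 1)) (by omega) (S j ω) (hω j (by omega))
        rw [show N - (j + 1) + 1 = N - j by omega] at this
        simpa [e1, e2] using this
      · have e1 : e (j + 1) ω = 0 := indicator_of_notMem (s := {ω | ∀ i < j + 1, S i ω ∉ A}) hω 1
        simp [e1]
  have hN := key N le_rfl
  simp only [Nat.sub_self, h0, mul_one] at hN
  refine le_trans (le_of_eq ?_) hN
  have hmeas : MeasurableSet {ω | ∀ i < N, S i ω ∉ A} := by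
    have hset : {ω | ∀ i < N, S i ω ∉ A} = ⋂ i ∈ Finset.range N, (S i ⁻¹' A)ᶜ := by
      ext ω; simp
    rw [hset]
    exact Finset.measurableSet_biInter _ fun i _ => (hSm' i hA).compl
  rw [he, lintegral_indicator_one hmeas]

/-! ### Polynomial majorants of the concave power -/

/-- The power `t₊ ^ (9/10)`. -/
noncomputable def concavePower (t : ℝ) : ℝ := max t 0 ^ (9 / 10 : ℝ)

theorem concavePower_nonneg (t : ℝ) : 0 ≤ concavePower t := by
  unfold concavePower; positivity

theorem continuous_concavePower : Continuous concavePower := by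
  unfold concavePower
  exact (continuous_id.max continuous_const).rpow_const fun _ => Or.inr (by norm_num)

theorem concavePower_of_nonneg {t : ℝ} (ht : 0 ≤ t) : concavePower t = t ^ (9 / 10 : ℝ) := by
  rw [concavePower, max_eq_left ht]

/-- Halving the Taylor coefficient `-1/8` of `x²` leaves room to absorb the cubic term into `x⁴`,
making the bound global. -/
theorem sqrt_one_add_le {x : ℝ} (hx : -1 ≤ x) :
    √(1 + x) ≤ 1 + x / 2 - x ^ 2 / 16 + 5 * x ^ 4 := by
  have h0 : 0 ≤ 1 + x / 2 - x ^ 2 / 16 + 5 * x ^ 4 := by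
    nlinarith [sq_nonneg (x ^ 2 - 1 / 16), sq_nonneg x]
  refine Real.sqrt_le_iff.2 ⟨h0, ?_⟩
  -- The square of the right side minus `1 + x` is exactly the sum of the expressions in `h1` and
  -- `h2`.
  have h1 : x ^ 2 / 8 - x ^ 3 / 16 + 5 * x ^ 4 + x ^ 4 / 256 ≥ 0 := by
    have : 0 ≤ x ^ 2 * (1 / 8 - x / 16 + 5 * x ^ 2) := 
      mul_nonneg (sq_nonneg x) (by nlinarith [sq_nonneg (x - 1 / 10)])
    nlinarith [sq_nonneg (x ^ 2)]
  have h2 : 0 ≤ x ^ 4 * (5 + 5 * x - 5 * x ^ 2 / 8 + 25 * x ^ 4) := by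
    refine mul_nonneg (by positivity) ?_
    nlinarith [sq_nonneg (x ^ 2 - 1 / 10), sq_nonneg x]
  nlinarith

/-- Weighted AM-GM on `(1+x)^(4/5) · √(1+x)^(1/5)` reduces the power to the square root. The
negative quadratic term that drives the whole argument comes from there. -/
theorem concavePower_one_add_le (x : ℝ) :
    concavePower (1 + x) ≤ 1 + 9 / 10 * x - x ^ 2 / 80 + x ^ 4 := by
  rcases le_total (-1) x with hx | hx
  · have hx' : 0 ≤ 1 + x := by linarith
    have h := Real.geom_mean_le_arith_mean2_weighted (w₁ := 4 / 5) (w₂ := 1 / 5) (by norm_num)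
      (by norm_num) hx' (Real.sqrt_nonneg (1 + x)) (by norm_num)
    rw [concavePower_of_nonneg hx']
    have e : (1 + x) ^ (9 / 10 : ℝ) = (1 + x) ^ (4 / 5 : ℝ) * √(1 + x) ^ (1 / 5 : ℝ) := by
      rw [Real.sqrt_eq_rpow, ← Real.rpow_mul hx', ← Real.rpow_add_of_nonneg hx' (by norm_num)
        (by norm_num)]
      norm_num
    rw [e]
    linarith [sqrt_one_add_le hx]
  · rw [concavePower, max_eq_right (by linarith), Real.zero_rpow (by norm_num)]
    have h1 : 1 ≤ x ^ 2 := by nlinarith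
    nlinarith [mul_nonneg (sub_nonneg.2 h1) (sub_nonneg.2 h1)]

theorem concavePower_add_le {S : ℝ} (hS : 0 < S) (J : ℝ) :
    concavePower (S + J) ≤
      concavePower S * (1 + 9 / 10 * J / S - J ^ 2 / (80 * S ^ 2) + J ^ 4 / S ^ 4) := by
  have e : S + J = S * (1 + J / S) := by field_simp
  have e2 : concavePower (S * (1 + J / S)) = concavePower S * concavePower (1 + J / S) := by
    simp only [concavePower]
    rw [← Real.mul_rpow (le_max_right _ _) (le_max_right _ _), max_eq_left hS.le,
      mul_max_of_nonneg _ _ hS.le, mul_zero]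
  rw [e, e2]
  refine mul_le_mul_of_nonneg_left ?_ (concavePower_nonneg S)
  refine (concavePower_one_add_le _).trans (le_of_eq ?_)
  field_simp

/-! ### One Gaussian step -/

section GaussianStep

open scoped RealInnerProductSpace

variable {E : Type*} [NormedAddCommGroup E] [InnerProductSpace ℝ E] [FiniteDimensional ℝ E]
  [MeasurableSpace E] [BorelSpace E]

theorem integrable_norm_pow_stdGaussian (n : ℕ) :
    Integrable (fun ξ : E => ‖ξ‖ ^ n) (stdGaussian E) :=
  (IsGaussian.memLp_id (stdGaussian E) n (by simp)).integrable_norm_pow'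

theorem integral_inner_stdGaussian (v : E) : ∫ ξ, ⟪v, ξ⟫ ∂(stdGaussian E) = 0 :=
  integral_strongDual_stdGaussian (innerSL ℝ v)

theorem integral_inner_sq_stdGaussian (v : E) :
    ∫ ξ, ⟪v, ξ⟫ ^ 2 ∂(stdGaussian E) = ‖v‖ ^ 2 := by
  have h := variance_dual_stdGaussian (E := E) (innerSL ℝ v)
  rw [variance_of_integral_eq_zero (by fun_prop) (integral_strongDual_stdGaussian _)] at h
  simpa using h

theorem integrable_inner_stdGaussian (v : E) : Integrable (fun ξ => ⟪v, ξ⟫) (stdGaussian E) :=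
  IsGaussian.integrable_dual _ (innerSL ℝ v)

theorem integrable_inner_sq_stdGaussian (v : E) :
    Integrable (fun ξ => ⟪v, ξ⟫ ^ 2) (stdGaussian E) :=
  (IsGaussian.memLp_dual (stdGaussian E) (innerSL ℝ v) 2 (by simp)).integrable_sq

/-- Here `p`, `q`, `n` stand for `⟪v, ξ⟫`, `‖v‖`, `‖ξ‖`. The terms in `p` and `p²` are kept because
their Gaussian means are explicit; the quartic error is reduced to powers of `n` by Cauchy–Schwarz.
-/
theorem concavePower_step_le {S σ q p n : ℝ} (hS : 0 < S) (hp : |p| ≤ q * n) :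
    concavePower (S + (2 * σ * p + σ ^ 2 * n ^ 2)) ≤
      concavePower S * (1 + 9 / 5 * σ / S * p + 9 / 10 * σ ^ 2 / S * n ^ 2
        - σ ^ 2 / (40 * S ^ 2) * p ^ 2
        + (σ ^ 4 / (80 * S ^ 2) + 128 * σ ^ 4 * q ^ 4 / S ^ 4) * n ^ 4
        + 8 * σ ^ 8 / S ^ 4 * n ^ 8) := by
  refine (concavePower_add_le hS _).trans (mul_le_mul_of_nonneg_left ?_ (concavePower_nonneg S))
  set J := 2 * σ * p + σ ^ 2 * n ^ 2 with hJ
  have h2 : 2 * σ ^ 2 * p ^ 2 - σ ^ 4 * n ^ 4 ≤ J ^ 2 := by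
    nlinarith [sq_nonneg (2 * σ * p + 2 * (σ ^ 2 * n ^ 2)), sq_nonneg (σ * p + σ ^ 2 * n ^ 2)]
  have hp4 : p ^ 4 ≤ q ^ 4 * n ^ 4 := by
    have := pow_le_pow_left₀ (abs_nonneg p) hp 4
    rwa [mul_pow, show |p| ^ 4 = p ^ 4 from (by decide : Even 4).pow_abs p] at this
  have h4 : J ^ 4 ≤ 128 * σ ^ 4 * q ^ 4 * n ^ 4 + 8 * σ ^ 8 * n ^ 8 := by
    have h41 : J ^ 2 ≤ 2 * ((2 * σ * p) ^ 2 + (σ ^ 2 * n ^ 2) ^ 2) := by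
      nlinarith [sq_nonneg (2 * σ * p - σ ^ 2 * n ^ 2)]
    have h42 : (J ^ 2) ^ 2 ≤ (2 * ((2 * σ * p) ^ 2 + (σ ^ 2 * n ^ 2) ^ 2)) ^ 2 :=
      pow_le_pow_left₀ (sq_nonneg _) h41 2
    have h43 : (2 * ((2 * σ * p) ^ 2 + (σ ^ 2 * n ^ 2) ^ 2)) ^ 2 ≤
        8 * ((2 * σ * p) ^ 4 + (σ ^ 2 * n ^ 2) ^ 4) := by
      nlinarith [sq_nonneg ((2 * σ * p) ^ 2 - (σ ^ 2 * n ^ 2) ^ 2)]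
    have h44 : σ ^ 4 * p ^ 4 ≤ σ ^ 4 * (q ^ 4 * n ^ 4) :=
      mul_le_mul_of_nonneg_left hp4 (by positivity)
    nlinarith
  have h2' := div_le_div_of_nonneg_right h2 (show 0 ≤ 80 * S ^ 2 by positivity)
  have h4' := div_le_div_of_nonneg_right h4 (show 0 ≤ S ^ 4 by positivity)
  calc 1 + 9 / 10 * J / S - J ^ 2 / (80 * S ^ 2) + J ^ 4 / S ^ 4
      ≤ 1 + 9 / 10 * J / S - (2 * σ ^ 2 * p ^ 2 - σ ^ 4 * n ^ 4) / (80 * S ^ 2)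
        + (128 * σ ^ 4 * q ^ 4 * n ^ 4 + 8 * σ ^ 8 * n ^ 8) / S ^ 4 := by linarith
    _ = _ := by rw [hJ]; field_simp; ring

/-- The image of `concavePower` under one Gaussian step, in terms of bounds for the moments. -/
theorem integral_concavePower_le {M : ℝ}
    (h2 : ∫ ξ, ‖ξ‖ ^ 2 ∂(stdGaussian E) ≤ M) (h4 : ∫ ξ, ‖ξ‖ ^ 4 ∂(stdGaussian E) ≤ M)
    (h8 : ∫ ξ, ‖ξ‖ ^ 8 ∂(stdGaussian E) ≤ M) {S : ℝ} (hS : 0 < S) (σ : ℝ) (v : E) :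
    Integrable (fun ξ => concavePower (S + (2 * σ * ⟪v, ξ⟫ + σ ^ 2 * ‖ξ‖ ^ 2))) (stdGaussian E) ∧
    ∫ ξ, concavePower (S + (2 * σ * ⟪v, ξ⟫ + σ ^ 2 * ‖ξ‖ ^ 2)) ∂(stdGaussian E) ≤
      concavePower S * (1 + 9 / 10 * σ ^ 2 / S * M - σ ^ 2 / (40 * S ^ 2) * ‖v‖ ^ 2
        + (σ ^ 4 / (80 * S ^ 2) + 128 * σ ^ 4 * ‖v‖ ^ 4 / S ^ 4) * M + 8 * σ ^ 8 / S ^ 4 * M) := by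
  have i1 := (integrable_inner_stdGaussian v).const_mul (9 / 5 * σ / S)
  have i2 := (integrable_norm_pow_stdGaussian (E := E) 2).const_mul (9 / 10 * σ ^ 2 / S)
  have i3 := (integrable_inner_sq_stdGaussian v).const_mul (σ ^ 2 / (40 * S ^ 2))
  have i4 := (integrable_norm_pow_stdGaussian (E := E) 4).const_mul
    (σ ^ 4 / (80 * S ^ 2) + 128 * σ ^ 4 * ‖v‖ ^ 4 / S ^ 4)
  have i5 := (integrable_norm_pow_stdGaussian (E := E) 8).const_mul (8 * σ ^ 8 / S ^ 4)
  have i0 : Integrable (fun _ : E => (1 : ℝ)) (stdGaussian E) := integrable_const _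
  have hint := (((((i0.add i1).add i2).sub i3).add i4).add i5).const_mul (concavePower S)
  have hle : ∀ ξ : E, concavePower (S + (2 * σ * ⟪v, ξ⟫ + σ ^ 2 * ‖ξ‖ ^ 2)) ≤ _ := fun ξ =>
    concavePower_step_le (σ := σ) hS (abs_real_inner_le_norm v ξ)
  have hi : Integrable (fun ξ : E => concavePower (S + (2 * σ * ⟪v, ξ⟫ + σ ^ 2 * ‖ξ‖ ^ 2)))
      (stdGaussian E) := by
    refine hint.mono' (Continuous.aestronglyMeasurable ?_) (Filter.Eventually.of_forall fun ξ => ?_)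
    · exact continuous_concavePower.comp (by fun_prop)
    · rw [Real.norm_of_nonneg (concavePower_nonneg _)]
      exact hle ξ
  refine ⟨hi, (integral_mono hi hint hle).trans ?_⟩
  rw [integral_const_mul]
  refine mul_le_mul_of_nonneg_left ?_ (concavePower_nonneg S)
  simp only [Pi.add_apply, Pi.sub_apply]
  rw [integral_add (by exact (((i0.add i1).add i2).sub i3).add i4) i5,
    integral_add (by exact ((i0.add i1).add i2).sub i3) i4,
    integral_sub (by exact (i0.add i1).add i2) i3,
    integral_add (by exact i0.add i1) i2, integral_add i0 i1]
  simp only [integral_const_mul, integral_inner_stdGaussian, integral_inner_sq_stdGaussian]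
  have := mul_le_mul_of_nonneg_left h2 (show 0 ≤ 9 / 10 * σ ^ 2 / S by positivity)
  have := mul_le_mul_of_nonneg_left h4
    (show 0 ≤ σ ^ 4 / (80 * S ^ 2) + 128 * σ ^ 4 * ‖v‖ ^ 4 / S ^ 4 by positivity)
  have := mul_le_mul_of_nonneg_left h8 (show 0 ≤ 8 * σ ^ 8 / S ^ 4 by positivity)
  simp only [integral_const, probReal_univ, smul_eq_mul, mul_one, mul_zero, add_zero]
  linarith

/-- One Gaussian step decreases `concavePower`, at the distance `‖v‖` of order `r`. -/
theorem integral_concavePower_sub_le {M : ℝ} (hM : 1 ≤ M)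
    (h2 : ∫ ξ, ‖ξ‖ ^ 2 ∂(stdGaussian E) ≤ M) (h4 : ∫ ξ, ‖ξ‖ ^ 4 ∂(stdGaussian E) ≤ M)
    (h8 : ∫ ξ, ‖ξ‖ ^ 8 ∂(stdGaussian E) ≤ M) {S σ r : ℝ} (hσ : 0 < σ) (hr : 0 < r)
    (hσr : 1000 * M * σ ≤ r) (hS : 1000 * M * σ * r ≤ S) (hSr : 1000 * M * S ≤ r ^ 2) {v : E}
    (hv : r ^ 2 / 4 ≤ ‖v‖ ^ 2) (hv' : ‖v‖ ^ 2 ≤ 2 * r ^ 2) :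
    ∫ ξ, concavePower (S + (2 * σ * ⟪v, ξ⟫ + σ ^ 2 * ‖ξ‖ ^ 2)) ∂(stdGaussian E) ≤
      concavePower S - σ ^ 2 * r ^ 2 / 400 * (concavePower S / S ^ 2) := by
  have hS0 : 0 < S := lt_of_lt_of_le (by positivity) hS
  refine (integral_concavePower_le h2 h4 h8 hS0 σ v).2.trans ?_
  have e : concavePower S - σ ^ 2 * r ^ 2 / 400 * (concavePower S / S ^ 2)
      = concavePower S * (1 - σ ^ 2 * r ^ 2 / 400 / S ^ 2) := by ring
  rw [e]
  refine mul_le_mul_of_nonneg_left ?_ (concavePower_nonneg S)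
  have hSS : (1000 * M * σ * r) ^ 2 ≤ S ^ 2 := pow_le_pow_left₀ (by positivity) hS 2
  have t2 : 1000 * (σ ^ 2 * M) ≤ r ^ 2 := by
    have : σ ≤ r := le_trans (by nlinarith) hσr
    nlinarith [mul_le_mul hσr this hσ.le hr.le]
  have t3 : 500000 * (σ ^ 2 * M * r ^ 2) ≤ S ^ 2 := by
    refine le_trans ?_ hSS
    have : 0 ≤ σ ^ 2 * r ^ 2 * M * (M - 1) := by
      have := sub_nonneg.2 hM
      positivity
    nlinarith [mul_nonneg (mul_nonneg (sq_nonneg σ) (sq_nonneg r)) (zero_le_one.trans hM)]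
  have t4 : 128 * σ ^ 2 * ‖v‖ ^ 4 * M ≤ r ^ 2 / 900 * S ^ 2 := by
    have : ‖v‖ ^ 4 ≤ 4 * r ^ 4 := by nlinarith [sq_nonneg ‖v‖]
    have h := mul_le_mul_of_nonneg_left this (show 0 ≤ 128 * σ ^ 2 * M by positivity)
    have h' := mul_le_mul_of_nonneg_left t3 (sq_nonneg r)
    nlinarith
  have t5 : 8 * σ ^ 6 * M ≤ r ^ 2 / 1100 * S ^ 2 := by
    have hs2 : σ ^ 2 ≤ r ^ 2 := by nlinarith [mul_nonneg (sq_nonneg σ) (sub_nonneg.2 hM)]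
    have hs4 : σ ^ 4 ≤ r ^ 4 := by nlinarith [sq_nonneg σ, sq_nonneg r]
    have h := mul_le_mul_of_nonneg_left hs4 (show 0 ≤ 8 * σ ^ 2 * M by positivity)
    have h' := mul_le_mul_of_nonneg_left t3 (sq_nonneg r)
    nlinarith [mul_nonneg (sq_nonneg r) (sq_nonneg S)]
  -- With `σ²/S²` factored out, the concavity gain is at least `r²/160`. The drift `9/10 · S M` is
  -- below `r²/1000`, and the remaining errors are controlled by `t2`, `t4`, `t5`.
  have main : 9 / 10 * S * M - ‖v‖ ^ 2 / 40 + σ ^ 2 * M / 80 +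
      (128 * σ ^ 2 * ‖v‖ ^ 4 * M) / S ^ 2 + (8 * σ ^ 6 * M) / S ^ 2 ≤ - (r ^ 2 / 400) := by
    have u4 := (div_le_iff₀ (by positivity : 0 < S ^ 2)).2 t4
    have u5 := (div_le_iff₀ (by positivity : 0 < S ^ 2)).2 t5
    nlinarith
  have := mul_le_mul_of_nonneg_left main (show 0 ≤ σ ^ 2 / S ^ 2 by positivity)
  have e1 : 1 + 9 / 10 * σ ^ 2 / S * M - σ ^ 2 / (40 * S ^ 2) * ‖v‖ ^ 2
        + (σ ^ 4 / (80 * S ^ 2) + 128 * σ ^ 4 * ‖v‖ ^ 4 / S ^ 4) * M + 8 * σ ^ 8 / S ^ 4 * M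
      = 1 + σ ^ 2 / S ^ 2 * (9 / 10 * S * M - ‖v‖ ^ 2 / 40 + σ ^ 2 * M / 80 +
      (128 * σ ^ 2 * ‖v‖ ^ 4 * M) / S ^ 2 + (8 * σ ^ 6 * M) / S ^ 2) := by
    field_simp
    ring
  have e2 : 1 - σ ^ 2 * r ^ 2 / 400 / S ^ 2 = 1 + σ ^ 2 / S ^ 2 * -(r ^ 2 / 400) := by ring
  rw [e1, e2]
  linarith

end GaussianStep

/-! ### From drift to avoidance of a ball -/

/-- A Lyapunov function bound for the probability that a random walk avoids a set for `N` steps. -/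
theorem measure_forall_notMem_le_of_drift {Ω E : Type*} [MeasurableSpace Ω] [AddCommGroup E]
    [MeasurableSpace E] [MeasurableAdd₂ E] {P : Measure Ω} [IsProbabilityMeasure P]
    {ξ : ℕ → Ω → E} (hξ : ∀ i, Measurable (ξ i)) (hind : iIndepFun ξ P) {μ : Measure E}
    (hlaw : ∀ i, P.map (ξ i) = μ) {A : Set E} (hA : MeasurableSet A) {f : E → ℝ}
    (hf : Measurable f) (hf0 : ∀ y, 0 ≤ f y) {c : ℝ} (hc : 0 < c) {N : ℕ} (hN : 0 < N)
    (hstep : ∀ y ∉ A, f y < c * N →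
      Integrable (fun z => f (y + z)) μ ∧ ∫ z, f (y + z) ∂μ ≤ f y - c) (x : E) :
    P {ω | ∀ j < N, x + ∑ i ∈ Finset.range j, ξ i ω ∉ A} ≤ ENNReal.ofReal (f x / (c * N)) := by
  have hμ : IsProbabilityMeasure μ := hlaw 0 ▸ Measure.isProbabilityMeasure_map (hξ 0).aemeasurable
  let F : ℕ → E → ℝ≥0∞ := fun k y =>
    if k = 0 then 1 else ENNReal.ofReal (min 1 (f y / (c * k)))
  have hF1 : ∀ k y, F k y ≤ 1 := by
    intro k y
    by_cases hk : k = 0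
    · simp [F, hk]
    · simp [F, hk]
  have hFm : ∀ k, Measurable (F k) := by
    intro k
    by_cases hk : k = 0
    · simp [F, hk]
    · simp only [F, hk, if_false]
      exact (measurable_const.min (hf.div_const _)).ennreal_ofReal
  have h := measure_forall_notMem_le hξ hind hlaw hA hFm (fun y => by simp [F]) (N := N) ?_ x
  · refine h.trans ?_
    simp only [F, hN.ne', if_false]
    exact ENNReal.ofReal_le_ofReal (min_le_right _ _)
  intro k hk y hy
  -- Where `f y ≥ c (k+1)` the supersolution is capped at `1`. Elsewhere `f y < c N`, so the drift
  -- hypothesis applies.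
  by_cases hfy : c * (k + 1 : ℕ) ≤ f y
  · have : F (k + 1) y = 1 := by
      have h1 : 1 ≤ f y / (c * (k + 1 : ℕ)) := (one_le_div (by positivity)).2 hfy
      simp only [F, Nat.succ_ne_zero, if_false]
      rw [min_eq_left h1, ENNReal.ofReal_one]
    rw [this]
    calc ∫⁻ z, F k (y + z) ∂μ ≤ ∫⁻ _, 1 ∂μ := lintegral_mono fun z => hF1 _ _
      _ = 1 := by simp
  · rw [not_le] at hfy
    have hkN : c * (k + 1 : ℕ) ≤ c * N := by
      gcongr
      exact_mod_cast hk
    obtain ⟨hi, hle⟩ := hstep y hy (hfy.trans_le hkN)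
    rcases Nat.eq_zero_or_pos k with rfl | hk0
    -- For `k = 0` this region has `f y < c`, and a decrease by `c` would make the mean of `f ≥ 0`
    -- negative.
    · have : 0 ≤ ∫ z, f (y + z) ∂μ := integral_nonneg fun z => hf0 _
      norm_num at hfy
      linarith
    · have hk0' : (0 : ℝ) < k := by exact_mod_cast hk0
      have hck : 0 < c * k := by positivity
      have hlt : f y / (c * (k + 1 : ℕ)) ≤ 1 := ((div_lt_one (by positivity)).2 hfy).le
      simp only [F, hk0.ne', Nat.succ_ne_zero, if_false]
      rw [min_eq_right hlt]
      calc ∫⁻ z, ENNReal.ofReal (min 1 (f (y + z) / (c * k))) ∂μ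
          ≤ ∫⁻ z, ENNReal.ofReal (f (y + z) / (c * k)) ∂μ :=
            lintegral_mono fun z => ENNReal.ofReal_le_ofReal (min_le_right _ _)
        _ = ENNReal.ofReal (∫ z, f (y + z) / (c * k) ∂μ) :=
            (ofReal_integral_eq_lintegral_ofReal (hi.div_const _)
              (Filter.Eventually.of_forall fun z => div_nonneg (hf0 _) hck.le)).symm
        _ ≤ ENNReal.ofReal (f y / (c * (k + 1 : ℕ))) := by
            refine ENNReal.ofReal_le_ofReal ?_
            -- The inequality `(f - c) / (c k) ≤ f / (c (k+1))` is equivalent to `f ≤ c (k+1)`, the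
            -- case at hand.
            rw [integral_div, div_le_div_iff₀ hck (by positivity)]
            push_cast at hfy ⊢
            nlinarith [mul_le_mul_of_nonneg_right hle (show 0 ≤ c * (k + 1 : ℝ) by positivity)]

open scoped RealInnerProductSpace in
/-- A Gaussian walk with steps of size `σ` that starts close to a ball of large radius `r` avoids
the ball of radius `r - ρ` for `N` steps only with small probability. -/
theorem gaussianWalk_avoid_closedBall_le {Ω E : Type*} [MeasurableSpace Ω]
    [NormedAddCommGroup E] [InnerProductSpace ℝ E] [FiniteDimensional ℝ E]
    [MeasurableSpace E] [BorelSpace E] {P : Measure Ω} [IsProbabilityMeasure P]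
    {M : ℝ} (hM : 1 ≤ M)
    (h2 : ∫ ξ, ‖ξ‖ ^ 2 ∂(stdGaussian E) ≤ M) (h4 : ∫ ξ, ‖ξ‖ ^ 4 ∂(stdGaussian E) ≤ M)
    (h8 : ∫ ξ, ‖ξ‖ ^ 8 ∂(stdGaussian E) ≤ M) {σ : ℝ} (hσ : 0 < σ)
    {ξ : ℕ → Ω → E} (hξ : ∀ i, Measurable (ξ i)) (hind : iIndepFun ξ P)
    (hlaw : ∀ i, P.map (ξ i) = (stdGaussian E).map (fun y => σ • y))
    {N : ℕ} (hN : 0 < N) {r ρ : ℝ} (hρ : 0 < ρ) (hρr : 2 * ρ ≤ r)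
    (hNr : 50 * M * (σ * √N) ≤ r) {x z : E} (hx : ‖x - z‖ ≤ r + 3 * ρ) :
    P {ω | ∀ j < N, x + ∑ i ∈ Finset.range j, ξ i ω ∉ Metric.closedBall z (r - ρ)} ≤
      ENNReal.ofReal ((20 * (16 * ρ + 1000 * M * σ) / (σ * √N)) ^ (9 / 10 : ℝ)) := by
  have hr : 0 < r := by linarith
  have hN0 : (0 : ℝ) < N := by exact_mod_cast hN
  have hsN : 0 < √(N : ℝ) := Real.sqrt_pos.2 hN0
  have hM0 : 0 < M := by linarith
  -- The shift `1000 M σ r` keeps `S`, off the target ball, well above the typical change `σ r` in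
  -- one step.
  set S : E → ℝ := fun y => ‖y - z‖ ^ 2 - (r - ρ) ^ 2 + 1000 * M * σ * r with hSdef
  -- `T` is the level of `S` where `f = c N`. Since `T² = σ²r²N/400`, the guaranteed decrease at `S
  -- = T` is exactly `c`, and `hNr` gives `1000 M T ≤ r²`.
  set T : ℝ := σ * r * √N / 20 with hT
  have hT0 : 0 < T := by positivity
  have hT2 : T ^ 2 = σ ^ 2 * r ^ 2 * N / 400 := by
    rw [hT, div_pow, mul_pow, mul_pow, Real.sq_sqrt hN0.le]; norm_num
  have hTr : 1000 * M * T ≤ r ^ 2 := by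
    rw [hT]; nlinarith
  set c : ℝ := T ^ (9 / 10 : ℝ) / N with hc
  have hc0 : 0 < c := by positivity
  have hcN : c * N = T ^ (9 / 10 : ℝ) := by rw [hc]; field_simp
  have hScont : Continuous S := by fun_prop
  have hSadd : ∀ y w : E, S (y + σ • w) = S y + (2 * σ * ⟪y - z, w⟫ + σ ^ 2 * ‖w‖ ^ 2) := by
    intro y w
    simp only [hSdef]
    rw [show y + σ • w - z = (y - z) + σ • w by abel, norm_add_sq_real, inner_smul_right,
      norm_smul, mul_pow, Real.norm_eq_abs, sq_abs]
    ring
  have h := measure_forall_notMem_le_of_drift hξ hind hlaw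
    (Metric.isClosed_closedBall (x := z) (ε := r - ρ)).measurableSet
    (f := fun y => concavePower (S y)) (continuous_concavePower.comp hScont).measurable
    (fun y => concavePower_nonneg _) hc0 hN ?_ x
  · refine h.trans (ENNReal.ofReal_le_ofReal ?_)
    rw [hcN]
    have hSx : S x ≤ (16 * ρ + 1000 * M * σ) * r := by
      have := pow_le_pow_left₀ (norm_nonneg _) hx 2
      simp only [hSdef]
      nlinarith
    have hb : 0 ≤ (16 * ρ + 1000 * M * σ) * r := by positivity
    calc concavePower (S x) / T ^ (9 / 10 : ℝ)
        ≤ ((16 * ρ + 1000 * M * σ) * r) ^ (9 / 10 : ℝ) / T ^ (9 / 10 : ℝ) := by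
          gcongr
          exact Real.rpow_le_rpow (le_max_right _ _) (max_le hSx hb) (by norm_num)
      _ = (20 * (16 * ρ + 1000 * M * σ) / (σ * √N)) ^ (9 / 10 : ℝ) := by
          rw [← Real.div_rpow hb hT0.le]
          congr 1
          rw [hT]; field_simp
  · intro y hy hfy
    rw [hcN] at hfy
    have hy' : r - ρ < ‖y - z‖ := by
      rwa [Metric.mem_closedBall, not_le, dist_eq_norm] at hy
    have hyr : (r - ρ) ^ 2 ≤ ‖y - z‖ ^ 2 := pow_le_pow_left₀ (by linarith) hy'.le 2
    have hSy : 1000 * M * σ * r ≤ S y := by simp only [hSdef]; linarith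
    have hS0 : 0 < S y := lt_of_lt_of_le (by positivity) hSy
    have hST : S y < T := by
      rw [concavePower_of_nonneg hS0.le] at hfy
      exact (Real.rpow_lt_rpow_iff hS0.le hT0.le (by norm_num)).1 hfy
    have hSr : 1000 * M * S y ≤ r ^ 2 := le_trans (by gcongr) hTr
    have hSy' : S y ≤ r ^ 2 := le_trans (le_mul_of_one_le_left hS0.le (by linarith)) hSr
    -- Comparing the lower and upper bounds on `S y` gives this; when `σ` is too large, no such `y`
    -- exists.
    have hσr : 1000 * M * σ ≤ r :=
      le_of_mul_le_mul_right ((hSy.trans hSy').trans_eq (sq r)) hr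
    have hv : r ^ 2 / 4 ≤ ‖y - z‖ ^ 2 := by nlinarith
    have hv' : ‖y - z‖ ^ 2 ≤ 2 * r ^ 2 := by
      have h2 : 0 ≤ 1000 * M * σ * r := by positivity
      have h3 : (r - ρ) ^ 2 ≤ r ^ 2 := by nlinarith
      have h4 : ‖y - z‖ ^ 2 = S y + (r - ρ) ^ 2 - 1000 * M * σ * r := by simp only [hSdef]; ring
      linarith
    have hme : Measurable fun w : E => σ • w := by fun_prop
    have hco : Continuous fun w : E => concavePower (S (y + w)) :=
      continuous_concavePower.comp (hScont.comp (by fun_prop))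
    constructor
    · rw [integrable_map_measure hco.aestronglyMeasurable hme.aemeasurable]
      simpa only [Function.comp_def, hSadd] using
        (integral_concavePower_le h2 h4 h8 hS0 σ (y - z)).1
    · rw [integral_map hme.aemeasurable hco.aestronglyMeasurable]
      simp only [hSadd]
      refine (integral_concavePower_sub_le hM h2 h4 h8 hσ hr hσr hSy hSr hv hv').trans ?_
      have e : ∀ t : ℝ, 0 < t → t ^ (9 / 10 : ℝ) / t ^ 2 = t ^ (-(11 / 10) : ℝ) := by
        intro t ht
        rw [← Real.rpow_natCast, ← Real.rpow_sub ht]; norm_num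
      -- The decrease is proportional to `S^(-11/10)`, hence smallest at the top level `T`.
      have h5 : T ^ (9 / 10 : ℝ) / T ^ 2 ≤ concavePower (S y) / S y ^ 2 := by
        rw [concavePower_of_nonneg hS0.le, e _ hS0, e _ hT0]
        exact Real.rpow_le_rpow_of_nonpos hS0 hST.le (by norm_num)
      have h6 : σ ^ 2 * r ^ 2 / 400 * (T ^ (9 / 10 : ℝ) / T ^ 2) = c := by
        rw [hc, hT2]; field_simp
      have h7 := mul_le_mul_of_nonneg_left h5 (show 0 ≤ σ ^ 2 * r ^ 2 / 400 by positivity)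
      linarith

/-! ### Brownian motion as a Gaussian walk -/

open Matrix in
theorem multivariateGaussian_smul_one {d : ℕ} {v : ℝ} (hv : 0 ≤ v) :
    multivariateGaussian 0 (v • (1 : Matrix (Fin d) (Fin d) ℝ)) =
      (stdGaussian (Space d)).map fun y => √v • y := by
  have hps : (v • (1 : Matrix (Fin d) (Fin d) ℝ)).PosSemidef := Matrix.PosSemidef.one.smul hv
  have : IsProbabilityMeasure ((stdGaussian (Space d)).map fun y => √v • y) :=
    Measure.isProbabilityMeasure_map (by fun_prop)
  refine Measure.ext_of_charFun (funext fun t => ?_)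
  rw [charFun_multivariateGaussian hps, charFun_map_smul, charFun_stdGaussian]
  have h1 : ‖√v • t‖ ^ 2 = v * ‖t‖ ^ 2 := by
    rw [norm_smul, mul_pow, Real.norm_eq_abs, sq_abs, Real.sq_sqrt hv]
  have h2 : t.ofLp ⬝ᵥ (v • (1 : Matrix (Fin d) (Fin d) ℝ)).mulVec t.ofLp = v * ‖t‖ ^ 2 := by
    rw [Matrix.smul_mulVec, Matrix.one_mulVec, dotProduct_smul, smul_eq_mul,
      EuclideanSpace.real_norm_sq_eq]
    simp [dotProduct, sq]
  rw [h2, ← Complex.ofReal_pow, h1, inner_zero_right]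
  congr 1
  push_cast
  ring

/-- For a Brownian motion that starts close to a ball of large radius `r`, the probability that
it avoids the ball of radius `r - ρ` at the first `N` multiples of `h`. -/
theorem IsBrownianLaw.avoid_closedBall_le {d : ℕ} {α : ℝ} {x : Space d} {W : Measure (CPath d)}
    (hW : IsBrownianLaw α x W) {M : ℝ} (hM : 1 ≤ M)
    (h2 : ∫ ξ, ‖ξ‖ ^ 2 ∂(stdGaussian (Space d)) ≤ M)
    (h4 : ∫ ξ, ‖ξ‖ ^ 4 ∂(stdGaussian (Space d)) ≤ M)
    (h8 : ∫ ξ, ‖ξ‖ ^ 8 ∂(stdGaussian (Space d)) ≤ M) {h : ℝ≥0} (hαh : 0 < α * h)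
    {N : ℕ} (hN : 0 < N) {r ρ : ℝ} (hρ : 0 < ρ) (hρr : 2 * ρ ≤ r)
    (hNr : 50 * M * (√(α * h) * √N) ≤ r) {z : Space d} (hx : ‖x - z‖ ≤ r + 3 * ρ) :
    W {X | ∀ j < N, coord (j * h) X ∉ Metric.closedBall z (r - ρ)} ≤
      ENNReal.ofReal
        ((20 * (16 * ρ + 1000 * M * √(α * h)) / (√(α * h) * √N)) ^ (9 / 10 : ℝ)) := by
  have := hW.prob
  have hmono : Monotone fun j : ℕ => (j : ℝ≥0) * h := fun i j hij => by
    dsimp only; gcongr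
  have hind := hW.indep.nat hmono
  refine le_trans (le_of_eq ?_) (gaussianWalk_avoid_closedBall_le
    (ξ := fun i X => coord (((i + 1 : ℕ) : ℝ≥0) * h) X - coord ((i : ℝ≥0) * h) X) hM h2 h4 h8
    (Real.sqrt_pos.2 hαh) (fun i => (measurable_coord _).sub (measurable_coord _)) hind ?_ hN hρ hρr
    hNr hx)
  · refine measure_congr ?_
    filter_upwards [hW.start] with X hX
    have hsum : ∀ j : ℕ, x + ∑ i ∈ Finset.range j,
        (coord (((i + 1 : ℕ) : ℝ≥0) * h) X - coord ((i : ℝ≥0) * h) X) = coord (j * h) X := by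
      intro j
      rw [Finset.sum_range_sub (fun i : ℕ => coord ((i : ℝ≥0) * h) X), ← hX]
      simp
    refine propext ?_
    change (∀ j < N, _) ↔ (∀ j < N, _)
    simp only [hsum]
  · intro i
    have hl := (hW.law ((i : ℝ≥0) * h) (((i + 1 : ℕ) : ℝ≥0) * h) (hmono i.le_succ)).map_eq
    rw [hl, ← multivariateGaussian_smul_one hαh.le]
    congr 2
    push_cast
    ring

/-! ### Growth of the scales -/

section Scales

open Filter

variable {a : ℝ} {L₀ : ℕ}

theorem five_le_scaleL_rpow (ha : 0 < a) (hL : (5 : ℝ) ≤ (L₀ : ℝ) ^ a) (n : ℕ) :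
    (5 : ℝ) ≤ (scaleL a L₀ n : ℝ) ^ a := by
  induction n with
  | zero => exact hL
  | succ n ih =>
    refine ih.trans (Real.rpow_le_rpow (Nat.cast_nonneg _) ?_ ha.le)
    have h1 : 1 ≤ ⌊(scaleL a L₀ n : ℝ) ^ a / 5⌋₊ := (Nat.one_le_floor_iff _).2 (by linarith)
    rw [scaleL]
    exact_mod_cast Nat.le_mul_of_pos_left _ (by omega)

theorem scaleL_pos (ha : 0 < a) (hL : (5 : ℝ) ≤ (L₀ : ℝ) ^ a) (n : ℕ) : 0 < scaleL a L₀ n := by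
  rcases Nat.eq_zero_or_pos (scaleL a L₀ n) with h | h
  · have := five_le_scaleL_rpow ha hL n
    rw [h, Nat.cast_zero, Real.zero_rpow ha.ne'] at this
    norm_num at this
  · exact h

theorem one_le_scaleL (ha : 0 < a) (hL : (5 : ℝ) ≤ (L₀ : ℝ) ^ a) (n : ℕ) :
    (1 : ℝ) ≤ scaleL a L₀ n := by
  exact_mod_cast scaleL_pos ha hL n

theorem five_mul_scaleL_le (ha : 0 < a) (hL : (5 : ℝ) ≤ (L₀ : ℝ) ^ a) (n : ℕ) :
    5 * scaleL a L₀ n ≤ scaleL a L₀ (n + 1) := by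
  have h1 : 1 ≤ ⌊(scaleL a L₀ n : ℝ) ^ a / 5⌋₊ :=
    (Nat.one_le_floor_iff _).2 (by linarith [five_le_scaleL_rpow ha hL n])
  rw [scaleL]
  exact Nat.mul_le_mul_right _ (by omega)

/-- Rounding down to a multiple of five loses at most a factor two, since `⌊t⌋ ≥ t/2` for `t ≥ 1`.
-/
theorem half_scaleL_rpow_le (ha : 0 < a) (hL : (5 : ℝ) ≤ (L₀ : ℝ) ^ a) (n : ℕ) :
    1 / 2 * (scaleL a L₀ n : ℝ) ^ (1 + a) ≤ scaleL a L₀ (n + 1) := by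
  have h5 := five_le_scaleL_rpow ha hL n
  have h1 : 1 ≤ ⌊(scaleL a L₀ n : ℝ) ^ a / 5⌋₊ := (Nat.one_le_floor_iff _).2 (by linarith)
  have h1' : (1 : ℝ) ≤ ⌊(scaleL a L₀ n : ℝ) ^ a / 5⌋₊ := by exact_mod_cast h1
  have h2 := Nat.lt_floor_add_one ((scaleL a L₀ n : ℝ) ^ a / 5)
  have h0 : (0 : ℝ) < scaleL a L₀ n := by exact_mod_cast scaleL_pos ha hL n
  rw [scaleL, Real.rpow_add h0, Real.rpow_one]
  push_cast
  nlinarith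

theorem tendsto_scaleL (ha : 0 < a) (hL : (5 : ℝ) ≤ (L₀ : ℝ) ^ a) :
    Tendsto (fun n => (scaleL a L₀ n : ℝ)) atTop atTop := by
  refine tendsto_natCast_atTop_atTop.comp (StrictMono.tendsto_atTop (strictMono_nat_of_lt_succ ?_))
  intro n
  have := five_mul_scaleL_le ha hL n
  have := scaleL_pos ha hL n
  omega

theorem eventually_mul_scaleL_le (ha : 0 < a) (hL : (5 : ℝ) ≤ (L₀ : ℝ) ^ a) (B : ℝ) :
    ∀ᶠ n in atTop, B * scaleL a L₀ n ≤ scaleL a L₀ (n + 1) := by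
  filter_upwards [((tendsto_rpow_atTop ha).comp (tendsto_scaleL ha hL)).eventually_ge_atTop (2 * B)]
    with n hn
  refine le_trans ?_ (half_scaleL_rpow_le ha hL n)
  have h0 : (0 : ℝ) < scaleL a L₀ n := by exact_mod_cast scaleL_pos ha hL n
  rw [Real.rpow_add h0, Real.rpow_one]
  simp only [Function.comp] at hn
  nlinarith

theorem scaleL_dvd (a : ℝ) (L₀ k p : ℕ) : scaleL a L₀ k ∣ scaleL a L₀ (k + p) := by
  induction p with
  | zero => exact dvd_rfl
  | succ p ih => exact ih.trans (Dvd.intro_left _ rfl)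

theorem exists_mul_scaleL_rpow_le (ha : 0 < a) (hL : (5 : ℝ) ≤ (L₀ : ℝ) ^ a) (p : ℕ) :
    ∃ c : ℝ, 0 < c ∧ ∀ k, c * (scaleL a L₀ k : ℝ) ^ ((1 + a) ^ p) ≤ scaleL a L₀ (k + p) := by
  induction p with
  | zero => exact ⟨1, one_pos, fun k => by simp⟩
  | succ p ih =>
    obtain ⟨c, hc, h⟩ := ih
    refine ⟨1 / 2 * c ^ (1 + a), by positivity, fun k => ?_⟩
    have h0 : (0 : ℝ) ≤ scaleL a L₀ k := Nat.cast_nonneg _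
    have h1 := Real.rpow_le_rpow (by positivity) (h k) (by linarith : 0 ≤ 1 + a)
    rw [Real.mul_rpow hc.le (by positivity), ← Real.rpow_mul h0, ← pow_succ] at h1
    have h2 := half_scaleL_rpow_le ha hL (k + p)
    rw [← add_assoc]
    linarith

/-- The exponent `2 c₀ (log log L)²` is `o(log L)`, so `κ̃` is beaten by every positive power of
`L`. -/
theorem eventually_kappaTilde_le (ha : 0 < a) (hL : (5 : ℝ) ≤ (L₀ : ℝ) ^ a) (c₀ : ℝ) {δ : ℝ}
    (hδ : 0 < δ) : ∀ᶠ n in atTop, kappaTilde a c₀ L₀ n ≤ (scaleL a L₀ n : ℝ) ^ δ := by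
  have h1 : (fun x : ℝ => 2 * c₀ * Real.log x ^ 2) =o[atTop] (id : ℝ → ℝ) :=
    Real.isLittleO_pow_log_id_atTop.const_mul_left _
  have h2 := (Real.tendsto_log_atTop.comp (tendsto_scaleL ha hL)).eventually (h1.bound hδ)
  filter_upwards [h2] with n hn
  have h0 : (0 : ℝ) < scaleL a L₀ n := by exact_mod_cast scaleL_pos ha hL n
  rw [kappaTilde, Real.rpow_def_of_pos h0]
  refine Real.exp_le_exp.2 ?_
  have hlog : 0 ≤ Real.log (scaleL a L₀ n) := Real.log_nonneg (one_le_scaleL ha hL n)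
  simp only [Function.comp, id, Real.norm_eq_abs, abs_of_nonneg hlog] at hn
  linarith [le_abs_self (2 * c₀ * Real.log (Real.log (scaleL a L₀ n)) ^ 2)]

theorem scaleL_le_scaleDTilde {c₀ : ℝ} (hc₀ : 0 ≤ c₀) (n : ℕ) :
    (scaleL a L₀ n : ℝ) ≤ scaleDTilde a c₀ L₀ n :=
  le_mul_of_one_le_right (Nat.cast_nonneg _) (Real.one_le_exp (by positivity))

theorem mBar_spec (a : ℝ) : 0 < mBar a ∧
    1 - Real.log (1 - 12 * a - a ^ 2) / Real.log (1 + a) < (mBar a : ℝ) := by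
  refine Nat.sInf_mem
    (s := {m : ℕ | 0 < m ∧ 1 - Real.log (1 - 12 * a - a ^ 2) / Real.log (1 + a) < (m : ℝ)}) ?_
  obtain ⟨m, hm⟩ := exists_nat_gt (1 - Real.log (1 - 12 * a - a ^ 2) / Real.log (1 + a))
  exact ⟨m + 1, Nat.succ_pos _, hm.trans (by push_cast; linarith)⟩

theorem one_lt_mul_pow_mBar (ha : 0 < a) (hq : 0 < 1 - 12 * a - a ^ 2) :
    1 < (1 - 12 * a - a ^ 2) * (1 + a) ^ (mBar a - 1) := by
  obtain ⟨hm, h⟩ := mBar_spec a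
  have hl : 0 < Real.log (1 + a) := Real.log_pos (by linarith)
  have hc : ((mBar a - 1 : ℕ) : ℝ) = mBar a - 1 := by push_cast [hm]; rfl
  have h1 : 0 < Real.log (1 - 12 * a - a ^ 2) + (mBar a - 1 : ℕ) * Real.log (1 + a) := by
    rw [hc]
    have h2 : -(Real.log (1 - 12 * a - a ^ 2) / Real.log (1 + a)) < mBar a - 1 := by linarith
    have h3 := mul_lt_mul_of_pos_right h2 hl
    rw [neg_mul, div_mul_cancel₀ _ hl.ne'] at h3
    linarith
  rw [← Real.log_pow, ← Real.log_mul hq.ne' (by positivity)] at h1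
  exact (Real.log_pos_iff (by positivity)).1 h1

/-- From level `k`, `m̄ - 1` steps raise the scale to about the power `(1+a)^(m̄-1)`, which exceeds
`1/(1 - 12a - a²)`. Weakening `12a` to `100a/9` leaves enough room for the factor `L^(a/2)` that
bounds `κ̃`. -/
theorem exists_scaleDTilde_le (ha : 0 < a) (ha' : a ≤ 1 / 100) (hL : (5 : ℝ) ≤ (L₀ : ℝ) ^ a)
    (c₀ : ℝ) : ∃ C : ℝ, 0 < C ∧ ∀ᶠ k in atTop, scaleDTilde a c₀ L₀ k ≤
      C * (scaleL a L₀ (k + (mBar a - 1)) : ℝ) ^ (1 - 100 / 9 * a) := by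
  obtain ⟨c, hc, h⟩ := exists_mul_scaleL_rpow_le ha hL (mBar a - 1)
  refine ⟨(c ^ (1 - 100 / 9 * a))⁻¹, by positivity, ?_⟩
  filter_upwards [eventually_kappaTilde_le ha hL c₀ (half_pos ha)] with k hk
  have h0 : (0 : ℝ) < scaleL a L₀ k := by exact_mod_cast scaleL_pos ha hL k
  have hq : 0 < 1 - 12 * a - a ^ 2 := by nlinarith
  have he : 1 + a / 2 ≤ (1 + a) ^ (mBar a - 1) * (1 - 100 / 9 * a) := by
    have h1 := one_lt_mul_pow_mBar ha hq
    set Q := (1 + a) ^ (mBar a - 1)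
    have hQ : 0 < Q := by positivity
    have h2 : (1 - 12 * a - a ^ 2) * (1 + a / 2) ≤ 1 - 100 / 9 * a := by
      nlinarith [pow_pos ha 3]
    have h3 := mul_le_mul_of_nonneg_left h2 hQ.le
    nlinarith
  have h1 := Real.rpow_le_rpow (by positivity) (h k) (by linarith : 0 ≤ 1 - 100 / 9 * a)
  rw [Real.mul_rpow hc.le (by positivity), ← Real.rpow_mul h0.le] at h1
  rw [← div_eq_inv_mul, le_div_iff₀' (by positivity)]
  refine le_trans (mul_le_mul_of_nonneg_left ?_ (by positivity)) h1
  calc scaleDTilde a c₀ L₀ k ≤ scaleL a L₀ k * (scaleL a L₀ k : ℝ) ^ (a / 2) :=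
        mul_le_mul_of_nonneg_left hk h0.le
    _ = (scaleL a L₀ k : ℝ) ^ (1 + a / 2) := by rw [Real.rpow_add h0, Real.rpow_one]
    _ ≤ _ := Real.rpow_le_rpow_of_exponent_le (one_le_scaleL ha hL k) he

end Scales

/-! ### Exterior balls of the dilated domain -/

theorem IsPreconnected.inter_frontier_nonempty_of_isOpen {α : Type*} [TopologicalSpace α]
    {s V : Set α} (hs : IsPreconnected s) (hV : IsOpen V) (h : (s ∩ V).Nonempty)
    (h' : (s ∩ Vᶜ).Nonempty) : (s ∩ frontier V).Nonempty := by
  by_contra hcon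
  have hcl : ∀ y ∈ s, y ∈ closure V → y ∈ V := fun y hy hyV => by
    by_contra hyn
    exact hcon ⟨y, hy, by rw [hV.frontier_eq]; exact ⟨hyV, hyn⟩⟩
  obtain ⟨w, hws, hwV⟩ := h'
  obtain ⟨y, -, hy1, hy2⟩ := hs V (closure V)ᶜ hV isClosed_closure.isOpen_compl
    (fun y hy => (em (y ∈ closure V)).imp (hcl y hy) id) h ⟨w, hws, fun hw => hwV (hcl w hws hw)⟩
  exact hy2 (subset_closure hy1)

/-- A segment from a point of `U/ε` to a point outside it, both within `3ρ` of `x`, crosses the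
boundary. The exterior ball there, dilated by `1/ε`, misses `U/ε`, so shrinking its radius by `ρ`
leaves only points at depth at least `ρ`. -/
theorem exists_exterior_ball_dilate {d : ℕ} {U : Set (Space d)} (hU : IsOpen U) {r₀ : ℝ}
    (hball : ∀ x ∈ frontier U, ∃ z : Space d, Metric.closedBall z r₀ ∩ closure U = {x})
    {ε ρ : ℝ} (hε : 0 < ε) (hρ : 0 < ρ) {x : Space d}
    (hx : Metric.infEDist x (dilate ε U)ᶜ ≤ ENNReal.ofReal (2 * ρ))
    (hx' : Metric.infEDist x (dilate ε U) < ENNReal.ofReal ρ) :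
    ∃ z : Space d, ‖x - z‖ ≤ r₀ / ε + 3 * ρ ∧
      ∀ y ∈ Metric.closedBall z (r₀ / ε - ρ), ENNReal.ofReal ρ ≤ Metric.infEDist y (dilate ε U) := by
  obtain ⟨v, hv, hxv⟩ := Metric.infEDist_lt_iff.1 hx'
  obtain ⟨w, hw, hxw⟩ := Metric.infEDist_lt_iff.1 (hx.trans_lt
    ((ENNReal.ofReal_lt_ofReal_iff (by linarith)).2 (by linarith : 2 * ρ < 3 * ρ)))
  rw [edist_lt_ofReal] at hxv hxw
  have hV : IsOpen (dilate ε U) := hU.preimage (continuous_const_smul ε)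
  obtain ⟨p, hp, hpf⟩ := (convex_segment v w).isPreconnected.inter_frontier_nonempty_of_isOpen hV
    ⟨v, left_mem_segment ℝ v w, hv⟩ ⟨w, right_mem_segment ℝ v w, hw⟩
  have hxp : p ∈ Metric.ball x (3 * ρ) :=
    (convex_ball x (3 * ρ)).segment_subset (by rw [Metric.mem_ball']; linarith)
      (by rwa [Metric.mem_ball']) hp
  have hpf' : ε • p ∈ frontier U := by
    have h := (Homeomorph.smulOfNeZero (α := Space d) ε hε.ne').preimage_frontier U
    change p ∈ (fun x => ε • x) ⁻¹' frontier U
    exact (Set.ext_iff.1 h p).2 hpf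
  obtain ⟨z, hz⟩ := hball _ hpf'
  have hdist : ∀ y : Space d, dist (ε • y) z = ε * dist y (ε⁻¹ • z) := by
    intro y
    rw [← abs_of_pos hε, ← Real.norm_eq_abs, ← dist_smul₀, smul_smul, Real.norm_eq_abs,
      abs_of_pos hε, mul_inv_cancel₀ hε.ne', one_smul]
  refine ⟨ε⁻¹ • z, ?_, fun y hy => ?_⟩
  · have h1 : ε • p ∈ Metric.closedBall z r₀ ∩ closure U := hz ▸ rfl
    have h2 : dist p (ε⁻¹ • z) ≤ r₀ / ε := by
      rw [le_div_iff₀' hε, ← hdist]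
      exact h1.1
    rw [← dist_eq_norm]
    linarith [dist_triangle x p (ε⁻¹ • z), Metric.mem_ball'.1 hxp]
  · refine Metric.le_infEDist.2 fun u hu => ?_
    -- A point of the domain in the closed ball would be the boundary contact point, which the open
    -- set `U` excludes.
    have h1 : r₀ / ε < dist u (ε⁻¹ • z) := by
      by_contra hcon
      rw [not_lt, le_div_iff₀' hε, ← hdist] at hcon
      have h2 : ε • u ∈ Metric.closedBall z r₀ ∩ closure U := ⟨hcon, subset_closure hu⟩
      rw [hz, mem_singleton_iff] at h2
      rw [hU.frontier_eq] at hpf'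
      exact hpf'.2 (h2 ▸ hu)
    rw [edist_dist]
    refine ENNReal.ofReal_le_ofReal ?_
    have h3 := dist_triangle u y (ε⁻¹ • z)
    rw [dist_comm u y] at h3
    linarith [Metric.mem_closedBall.1 hy]

/-! ### Exit estimate and conclusion -/

theorem exists_moment_bound (d : ℕ) : ∃ M : ℝ, 1 ≤ M ∧
    ∫ ξ, ‖ξ‖ ^ 2 ∂(stdGaussian (Space d)) ≤ M ∧ ∫ ξ, ‖ξ‖ ^ 4 ∂(stdGaussian (Space d)) ≤ M ∧
    ∫ ξ, ‖ξ‖ ^ 8 ∂(stdGaussian (Space d)) ≤ M :=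
  ⟨max 1 (max (∫ ξ, ‖ξ‖ ^ 2 ∂(stdGaussian (Space d))) (max (∫ ξ, ‖ξ‖ ^ 4 ∂(stdGaussian (Space d)))
    (∫ ξ, ‖ξ‖ ^ 8 ∂(stdGaussian (Space d))))), by simp⟩

theorem infEDist_lt_of_le_discreteExitTime {d : ℕ} {h : ℝ≥0} {ρ : ℝ} {V : Set (Space d)}
    {X : CPath d} {T : ℝ≥0∞} (hT : T ≤ discreteExitTime h ρ V X) {j : ℕ}
    (hj : ((j * h : ℝ≥0) : ℝ≥0∞) < T) :
    Metric.infEDist (coord (j * h) X) V < ENNReal.ofReal ρ := by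
  by_contra hcon
  exact (hj.trans_le hT).not_ge (sInf_le ⟨j, rfl, not_lt.1 hcon⟩)

/-- The exit probability bound for one Brownian motion, with the ratio `ρ / Λ` of the depth to the
square root of the available time. -/
theorem IsBrownianLaw.discreteExitTime_le {d : ℕ} {α : ℝ} {x : Space d} {W : Measure (CPath d)}
    (hW : IsBrownianLaw α x W) {M : ℝ} (hM : 1 ≤ M)
    (h2 : ∫ ξ, ‖ξ‖ ^ 2 ∂(stdGaussian (Space d)) ≤ M)
    (h4 : ∫ ξ, ‖ξ‖ ^ 4 ∂(stdGaussian (Space d)) ≤ M)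
    (h8 : ∫ ξ, ‖ξ‖ ^ 8 ∂(stdGaussian (Space d)) ≤ M) {ν : ℝ} (hν : 0 < ν)
    (hα : α ∈ Set.Icc (1 / (2 * ν)) (2 * ν)) {U : Set (Space d)} (hU : IsOpen U) {r₀ : ℝ}
    (hball : ∀ x ∈ frontier U, ∃ z : Space d, Metric.closedBall z r₀ ∩ closure U = {x})
    {ε ρ : ℝ} (hε : 0 < ε) {l Λ : ℕ} (hl : 0 < l) (hΛ : 0 < Λ) (hlΛ : l ∣ Λ) (hlρ : (l : ℝ) ≤ ρ)
    (hρr : 2 * ρ ≤ r₀ / ε) (hΛr : 50 * M * √(2 * ν) * Λ ≤ r₀ / ε)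
    (hx : Metric.infEDist x (dilate ε U)ᶜ ≤ ENNReal.ofReal (2 * ρ)) :
    W {X | ENNReal.ofReal ((Λ : ℝ) ^ 2) ≤ discreteExitTime ((l : ℝ≥0) ^ 2) ρ (dilate ε U) X} ≤
      ENNReal.ofReal ((20 * (16 * √(2 * ν) + 1000 * M) * ρ / Λ) ^ (9 / 10 : ℝ)) := by
  have hl0 : (0 : ℝ) < l := by exact_mod_cast hl
  have hΛ0 : (0 : ℝ) < Λ := by exact_mod_cast hΛ
  have hρ : 0 < ρ := hl0.trans_le hlρ
  have hα0 : 0 < α := lt_of_lt_of_le (by positivity) hα.1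
  have hsα : 0 < √α := Real.sqrt_pos.2 hα0
  obtain ⟨q, rfl⟩ := hlΛ
  have hq : 0 < q := Nat.pos_of_mul_pos_left hΛ
  have hq0 : (0 : ℝ) < q := by exact_mod_cast hq
  -- With `Λ = l q`, the sampling times strictly before `Λ²` include all `j l²` with `j < q²`, so
  -- the walk has `q²` steps and `√N = q`.
  have hlt : ∀ j < q ^ 2, ((j * (l : ℝ≥0) ^ 2 : ℝ≥0) : ℝ≥0∞) <
      ENNReal.ofReal (((l * q : ℕ) : ℝ) ^ 2) := by
    intro j hj
    have hj' : (j : ℝ) < (q : ℝ) ^ 2 := by exact_mod_cast hj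
    rw [← ENNReal.ofReal_coe_nnreal]
    refine (ENNReal.ofReal_lt_ofReal_iff (by positivity)).2 ?_
    push_cast
    nlinarith [pow_pos hl0 2]
  -- If `x` is already at distance `ρ` or more, the discrete exit time is almost surely `0` and
  -- there is nothing to estimate.
  by_cases hx' : Metric.infEDist x (dilate ε U) < ENNReal.ofReal ρ
  · obtain ⟨z, hxz, hz⟩ := exists_exterior_ball_dilate hU hball hε hρ hx hx'
    have hs : √(α * (((l : ℝ≥0) ^ 2 : ℝ≥0) : ℝ)) = √α * l := by
      push_cast
      rw [Real.sqrt_mul hα0.le, Real.sqrt_sq hl0.le]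
    have hsN : √(((q ^ 2 : ℕ) : ℝ)) = q := by push_cast; exact Real.sqrt_sq hq0.le
    have hsν : √α ≤ √(2 * ν) := Real.sqrt_le_sqrt hα.2
    have h := hW.avoid_closedBall_le hM h2 h4 h8 (h := (l : ℝ≥0) ^ 2) (N := q ^ 2) (by
      push_cast; positivity) (by positivity) hρ hρr (by
        rw [hs, hsN]
        refine le_trans ?_ hΛr
        push_cast
        calc 50 * M * (√α * l * q) = 50 * M * √α * (l * q) := by ring
          _ ≤ 50 * M * √(2 * ν) * (l * q) := by gcongr) hxz
    refine (measure_mono ?_).trans (h.trans (ENNReal.ofReal_le_ofReal ?_))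
    · intro X hX j hj hmem
      exact (infEDist_lt_of_le_discreteExitTime hX (hlt j hj)).not_ge (hz _ hmem)
    · rw [hs, hsN]
      refine Real.rpow_le_rpow (by positivity) ?_ (by norm_num)
      -- The lower bound on `α` lets `ρ` be absorbed into `√α √(2ν) ρ`, so that `√α` cancels from
      -- the ratio.
      have h1 : 1 ≤ √α * √(2 * ν) := by
        rw [← Real.sqrt_mul hα0.le]
        refine Real.one_le_sqrt.2 ?_
        have := (div_le_iff₀ (by positivity : 0 < 2 * ν)).1 hα.1
        linarith
      push_cast
      rw [div_le_div_iff₀ (by positivity) (by positivity)]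
      have h3 : 20 * (16 * ρ + 1000 * M * (√α * l)) ≤
          √α * (20 * (16 * √(2 * ν) + 1000 * M) * ρ) := by
        have h5 : ρ ≤ √α * √(2 * ν) * ρ := le_mul_of_one_le_left hρ.le h1
        have h6 : M * √α * l ≤ M * √α * ρ := by gcongr
        nlinarith
      have h7 := mul_le_mul_of_nonneg_right h3 (show (0 : ℝ) ≤ l * q by positivity)
      linarith
  · have h0 : W {X | ENNReal.ofReal (((l * q : ℕ) : ℝ) ^ 2) ≤
        discreteExitTime ((l : ℝ≥0) ^ 2) ρ (dilate ε U) X} = 0 := by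
      refine measure_mono_null (t := {X | ¬coord 0 X = x})
        (fun X hX hX0 => hx' ?_) (ae_iff.1 hW.start)
      have h1 := infEDist_lt_of_le_discreteExitTime hX (hlt 0 (by positivity))
      rw [Nat.cast_zero, zero_mul, hX0] at h1
      exact h1
    rw [h0]
    exact zero_le

theorem mainTheorem10 {d : ℕ} (hd : 3 ≤ d)
    {Ω : Type*} [MeasurableSpace Ω] (Pr : Measure Ω)
    (τ : Space d → Ω → Ω) (A : Space d → Ω → Matrix (Fin d) (Fin d) ℝ) (b : Space d → Ω → Space d)
    (ν η₀ : ℝ) (hν : 1 < ν) (hη₀ : 0 < η₀)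
    (henv : IsSteadyEnvironment Pr τ A b ν η₀)
    (P : Space d → Ω → Measure (CPath d))
    (hP : ∀ x ω, IsDiffusionLaw (fun y => A y ω) (fun y => b y ω) x (P x ω))
    (U : Set (Space d)) (hU : IsExteriorBallDomain U)
    (β a : ℝ) (hβ : β ∈ Set.Ioc (0 : ℝ) (1 / 2)) (ha : a ∈ Set.Ioc (0 : ℝ) (β / (1000 * d)))
    (c₀ : ℝ) (hc₀ : 0 < c₀)
    (L₀ : ℕ) (hL₀ : 5 ∣ L₀) (hL₀a : (5 : ℝ) ≤ (L₀ : ℝ) ^ a)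
    (hconst : ∀ n, effectiveDiffusivity Pr P a c₀ L₀ n ∈ Set.Icc (1 / (2 * ν)) (2 * ν))
    (W : ℕ → Space d → Measure (CPath d))
    (hW : ∀ n x, IsBrownianLaw (effectiveDiffusivity Pr P a c₀ L₀ n) x (W n x)) :
    ∃ C : ℝ, 0 < C ∧ ∃ N : ℕ, ∀ n, N ≤ n → ∀ ε : ℝ, 0 < ε →
      (scaleL a L₀ n : ℝ) ≤ 1 / ε → 1 / ε < (scaleL a L₀ (n + 1) : ℝ) →
      (⨆ x ∈ {x : Space d | Metric.infEDist x (dilate ε U)ᶜ ≤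
            ENNReal.ofReal (2 * scaleDTilde a c₀ L₀ (n - mBar a))},
          W (n - mBar a) x
            {X | ENNReal.ofReal ((scaleL a L₀ (n - 1) : ℝ) ^ 2) ≤ tauTwo a c₀ L₀ U ε n X}) ≤
        ENNReal.ofReal (C * (scaleL a L₀ (n - 1) : ℝ) ^ (-10 * a)) := by
  obtain ⟨M, hM, h2, h4, h8⟩ := exists_moment_bound d
  obtain ⟨r₀, hr₀, hball⟩ := hU.exterior_ball
  have ha0 : 0 < a := ha.1
  have ha1 : a ≤ 1 / 100 := by
    refine ha.2.trans ?_
    have hd' : (3 : ℝ) ≤ d := by exact_mod_cast hd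
    rw [div_le_div_iff₀ (by positivity) (by norm_num)]
    linarith [hβ.2]
  obtain ⟨C, hC, hCev⟩ := exists_scaleDTilde_le ha0 ha1 hL₀a c₀
  obtain ⟨K₁, hK₁⟩ := Filter.eventually_atTop.1 hCev
  -- Superlinear growth makes `r₀/ε ≥ r₀ L_n` exceed the needed multiples of `L_{n-1}`: one for `2ρ
  -- ≤ r`, one for the diffusive range.
  obtain ⟨K₂, hK₂⟩ := Filter.eventually_atTop.1 (eventually_mul_scaleL_le ha0 hL₀a
    (max (2 * C) (50 * M * √(2 * ν)) / r₀))
  set B : ℝ := 20 * (16 * √(2 * ν) + 1000 * M) with hB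
  have hB0 : 0 < B := by positivity
  refine ⟨(B * C) ^ (9 / 10 : ℝ), by positivity, mBar a + K₁ + K₂, fun n hn ε hε hLε _ => ?_⟩
  have hm := (mBar_spec a).1
  -- The truncated subtractions are harmless because `n ≥ m̄ ≥ 1`.
  have hidx : n - mBar a + (mBar a - 1) = n - 1 := by omega
  have hidx' : n - 1 + 1 = n := by omega
  have hD := hK₁ (n - mBar a) (by omega)
  rw [hidx] at hD
  have hr := hK₂ (n - 1) (by omega)
  rw [hidx', div_mul_eq_mul_div, div_le_iff₀' hr₀] at hr
  have hΛ := scaleL_pos ha0 hL₀a (n - 1)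
  have hdvd : scaleL a L₀ (n - mBar a) ∣ scaleL a L₀ (n - 1) := hidx ▸ scaleL_dvd a L₀ _ _
  have hΛ1 := one_le_scaleL ha0 hL₀a (n - 1)
  set Λ := scaleL a L₀ (n - 1)
  set ρ := scaleDTilde a c₀ L₀ (n - mBar a)
  have hΛ0 : (0 : ℝ) < Λ := by linarith
  have hr' : max (2 * C) (50 * M * √(2 * ν)) * Λ ≤ r₀ / ε := by
    refine hr.trans ?_
    rw [div_eq_mul_one_div]
    exact mul_le_mul_of_nonneg_left hLε hr₀.le
  have hlρ : (scaleL a L₀ (n - mBar a) : ℝ) ≤ ρ := scaleL_le_scaleDTilde hc₀.le _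
  refine iSup₂_le fun x hx => ((hW (n - mBar a) x).discreteExitTime_le hM h2 h4 h8 (by linarith)
    (hconst _) hU.isOpen hball hε (scaleL_pos ha0 hL₀a _) hΛ hdvd hlρ ?_ ?_ hx).trans
    (ENNReal.ofReal_le_ofReal ?_)
  · refine le_trans ?_ hr'
    have h1 : (Λ : ℝ) ^ (1 - 100 / 9 * a) ≤ Λ := by
      conv_rhs => rw [← Real.rpow_one (Λ : ℝ)]
      exact Real.rpow_le_rpow_of_exponent_le hΛ1 (by linarith)
    calc 2 * ρ ≤ 2 * (C * Λ) := by
          gcongr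
          exact hD.trans (by gcongr)
      _ = 2 * C * Λ := by ring
      _ ≤ _ := by gcongr; exact le_max_left _ _
  · refine le_trans ?_ hr'
    gcongr
    exact le_max_right _ _
  · have h1 : B * ρ / Λ ≤ B * C * (Λ : ℝ) ^ (-(100 / 9 * a)) := by
      rw [div_le_iff₀ hΛ0]
      calc B * ρ ≤ B * (C * (Λ : ℝ) ^ (1 - 100 / 9 * a)) := by gcongr
        _ = B * C * ((Λ : ℝ) ^ (-(100 / 9 * a)) * (Λ : ℝ) ^ (1 : ℝ)) := by
          rw [← Real.rpow_add hΛ0, show -(100 / 9 * a) + 1 = 1 - 100 / 9 * a by ring]; ring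
        _ = _ := by rw [Real.rpow_one]; ring
    have hρ0 : 0 ≤ ρ := le_trans (Nat.cast_nonneg _) hlρ
    refine (Real.rpow_le_rpow (by positivity) h1 (by norm_num)).trans (le_of_eq ?_)
    rw [Real.mul_rpow (by positivity) (by positivity), ← Real.rpow_mul hΛ0.le]
    congr 2
    ring
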